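/- An \emph{arrow presentation} $G$ consists of finitely many circles (its vertices) with finitely many pairwise disjoint arrows (directed arcs) on them, labelled by the elements of a finite set $E(G)$ of edges so that each edge labels exactly two arrows. Let the arrows of an edge $e$ be $\overrightarrow{p_1p_2}$ and $\overrightarrow{q_1q_2}$. The deletion $G\setminus e$ is obtained by forgetting the two arrows but keeping the arcs on which they lie. The contraction $G/e$ (respectively the Penrose-contraction $G\dagger e$) is obtained by deleting the two arrows together with the interiors of their arcs and identifying $p_1$ with $q_2$ and $p_2$ with $q_1$ (respectively $p_1$ with $q_1$ and $p_2$ with $q_2$). In each case $e$ is removed from the edge set. The \emph{topological transition polynomial} $\tilde{Q}(G;(\mathbf a,\mathbf b,\mathbf c),t)$, where $(\mathbf a,\mathbf b,\mathbf c)=\{(a_e,b_e,c_e)\}_{e\in E(G)}$, is determined by $$\tilde Q(G)=a_e\,\tilde Q(G/e)+b_e\,\tilde Q(G\setminus e)+c_e\,\tilde Q(G\dagger e)\quad\text{for every edge } e,$$ and $\tilde Q(G)=t^{p}$ if $G$ has no edges and $p$ vertices. A \emph{coupling} of an edge $f$ of $G$ and an edge $e$ of an arrow presentation $H$ is a bijection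 $\varphi$ from the two arrows of $f$ to the two arrows of $e$. If $\varphi$ sends $\overrightarrow{p_1p_2}$ to $\overrightarrow{q_1q_2}$ and $\overrightarrow{p_3p_4}$ to $\overrightarrow{q_3q_4}$, the \emph{2-sum} $G\oplus_\varphi H$ is obtained from the disjoint union of $G$ and $H$ by deleting these four arrows with the interiors of their arcs and identifying $p_i$ with $q_i$ for $i=1,\dots,4$. Given, for each edge $f$ of $G$, an arrow presentation $H^{(f)}$ (all arrow presentations being distinct), an edge $e^{(f)}$ of $H^{(f)}$ and a coupling $\varphi_f$ of $f$ and $e^{(f)}$, the \emph{tensor product} $G\otimes_{\boldsymbol\varphi}\{H^{(f)}\}_{f\in E(G)}$ is obtained from $G$ by taking successively, for each edge $f$ of $G$, the 2-sum with $H^{(f)}$ with respect to $\varphi_f$. Its edges are the edges of the $H^{(f)}$ other than the $e^{(f)}$. \textbf{Theorem.} Let $G$, $\{H^{(f)}\}_{f\in E(G)}$, $e^{(f)}$ and $\boldsymbol\varphi$ be as above, and let $t$ and $a_x,b_x,c_x$, for $x$ an edge of the tensor product, be indeterminates. Then for each edge $f$ of $G$ the system $$\begin{bmatrix} t^2&t&t\\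 t&t^2&t\\ t&t&t^2\end{bmatrix}\begin{bmatrix}\phi^{(f)}_{\parallel}\\ \phi^{(f)}_{=}\\ \phi^{(f)}_{\times}\end{bmatrix}=\begin{bmatrix}\tilde Q(H^{(f)}/e^{(f)};(\mathbf a,\mathbf b,\mathbf c),t)\\ \tilde Q(H^{(f)}\setminus e^{(f)};(\mathbf a,\mathbf b,\mathbf c),t)\\ \tilde Q(H^{(f)}\dagger e^{(f)};(\mathbf a,\mathbf b,\mathbf c),t)\end{bmatrix}$$ has a unique solution in the polynomial ring $\mathbb Z[t,a_x,b_x,c_x]$, and, with these solutions, $$\tilde Q\big(G\otimes_{\boldsymbol\varphi}\{H^{(f)}\}_{f\in E(G)};(\mathbf a,\mathbf b,\mathbf c),t\big)=\tilde Q\big(G;(\boldsymbol\phi_{\parallel},\boldsymbol\phi_{=},\boldsymbol\phi_{\times}),t\big).$$ -/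

import Mathlib

universe u

/-- `glue ι σ j` is the map `j` on a set of points, changed on the points `ι k`: each `ι k` is
now identified with `ι (σ k)`. -/
noncomputable def glue {K P : Type*} (ι : K → P) (σ : K → K) (j : P → P) : P → P :=
  Function.extend ι (ι ∘ σ) j

theorem glue_apply {K P : Type*} {ι : K → P} (hι : Function.Injective ι) (σ : K → K)
    (j : P → P) (k : K) : glue ι σ j (ι k) = ι (σ k) :=
  hι.extend_apply _ _ k

theorem glue_apply_of_notMem {K P : Type*} {ι : K → P} (σ : K → K)
    (j : P → P) {p : P} (hp : p ∉ Set.range ι) : glue ι σ j p = j p :=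
  Function.extend_apply' _ _ p (fun h => hp h)

theorem glue_involutive {K P : Type*} {ι : K → P} (hι : Function.Injective ι) {σ : K → K}
    (hσ : Function.Involutive σ) {j : P → P} (hj : Function.Involutive j)
    (hfix : ∀ k, j (ι k) = ι k) : Function.Involutive (glue ι σ j) := by
  intro p
  by_cases hp : p ∈ Set.range ι
  · obtain ⟨k, rfl⟩ := hp
    rw [glue_apply hι, glue_apply hι, hσ k]
  · have hq : j p ∉ Set.range ι := by
      rintro ⟨k, hk⟩
      apply hp
      refine ⟨k, ?_⟩
      rw [← hj p, ← hk, hfix k]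
    rw [glue_apply_of_notMem σ j hp, glue_apply_of_notMem σ j hq, hj p]

theorem glue_eq_self_iff {K P : Type*} {ι : K → P} (hι : Function.Injective ι) {σ : K → K}
    (hσ : ∀ k, σ k ≠ k) (j : P → P) (p : P) :
    glue ι σ j p = p ↔ j p = p ∧ p ∉ Set.range ι := by
  by_cases hp : p ∈ Set.range ι
  · obtain ⟨k, rfl⟩ := hp
    rw [glue_apply hι]
    simp [hι.eq_iff, hσ k]
  · rw [glue_apply_of_notMem σ j hp]
    simp [hp]

/-- A (finite) arrow presentation with edge set `E`.

Its circles are described by cutting them into finitely many closed arcs, the arrows and the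
remaining unmarked arcs. `Pt` is the set of end points of the unmarked arcs, and `arc` sends an
end of an unmarked arc to its other end. Every edge `e` labels two arrows, numbered `0` and `1`;
`pt (e, i, false)` is the tail and `pt (e, i, true)` the head of the `i`-th of them. On its other
side, an end of an unmarked arc either carries an arrow, or is identified with an end of an
unmarked arc, namely with its image under `join`. Thus the points fixed by `join` are exactly the
end points of the arrows. A circle without arrows consists of unmarked arcs only,
for instance of one arc whose two ends are joined. -/
structure ArrowPresentation (E : Type u) : Type (u + 1) where
  Pt : Type u
  finite_edges : Finite E
  finite_pt : Finite Pt
  arc : Pt → Pt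
  arc_involutive : Function.Involutive arc
  arc_ne : ∀ p, arc p ≠ p
  pt : E × Fin 2 × Bool → Pt
  pt_injective : Function.Injective pt
  join : Pt → Pt
  join_involutive : Function.Involutive join
  join_eq_self_iff : ∀ p, join p = p ↔ p ∈ Set.range pt

/-- The three ways to resolve an edge: contraction, deletion and Penrose-contraction. -/
inductive EdgeOp where
  | con
  | del
  | pen
  deriving DecidableEq

/-- If `p₁p₂` and `q₁q₂` are the two arrows of an edge, then deletion keeps the arcs of the
arrows, so it connects `p₁` to `p₂` and `q₁` to `q₂`; contraction identifies `p₁` with `q₂`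
and `p₂` with `q₁`; Penrose-contraction identifies `p₁` with `q₁` and `p₂` with `q₂`. -/
def EdgeOp.partner : EdgeOp → Fin 2 × Bool → Fin 2 × Bool
  | .con, (i, b) => (i.rev, !b)
  | .del, (i, b) => (i, !b)
  | .pen, (i, b) => (i.rev, b)

theorem EdgeOp.partner_involutive (o : EdgeOp) : Function.Involutive o.partner := by
  rintro ⟨i, b⟩
  cases o <;> simp [EdgeOp.partner]

theorem EdgeOp.partner_ne (o : EdgeOp) (k : Fin 2 × Bool) : o.partner k ≠ k := by
  obtain ⟨i, b⟩ := k
  cases o <;> revert i b <;> decide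

/-- A coupling of an edge `f` and an edge `e`: a bijection from the pair of arrows constituting
`f` to the pair of arrows constituting `e`. -/
abbrev Coupling : Type := Fin 2 ≃ Fin 2

namespace ArrowPresentation

variable {E F : Type u}

/-- Two points are related if they are the two ends of an unmarked arc, or are identified, or are
the tail and the head of an arrow. -/
def Adjacent (G : ArrowPresentation E) (p q : G.Pt) : Prop :=
  q = G.arc p ∨ q = G.join p ∨
    ∃ (e : E) (i : Fin 2), p = G.pt (e, i, false) ∧ q = G.pt (e, i, true)

/-- The vertices, i.e. the circles: the classes of the equivalence relation generated by
`Adjacent`. -/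
def Vertex (G : ArrowPresentation E) : Type u := Quot G.Adjacent

/-- The arrow presentation obtained by contracting, deleting or Penrose-contracting `e`. -/
noncomputable def surgery (G : ArrowPresentation E) (o : EdgeOp) (e : E) :
    ArrowPresentation {x : E // x ≠ e} where
  Pt := G.Pt
  finite_edges := have := G.finite_edges; inferInstance
  finite_pt := G.finite_pt
  arc := G.arc
  arc_involutive := G.arc_involutive
  arc_ne := G.arc_ne
  pt := fun x => G.pt (x.1.1, x.2)
  pt_injective := by
    rintro ⟨⟨x, hx⟩, k⟩ ⟨⟨y, hy⟩, l⟩ h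
    have := G.pt_injective h
    simp_all
  join := glue (fun k => G.pt (e, k)) o.partner G.join
  join_involutive := by
    refine glue_involutive (fun k l h => ?_) o.partner_involutive G.join_involutive
      (fun k => (G.join_eq_self_iff _).2 ⟨_, rfl⟩)
    have := G.pt_injective h
    simp_all
  join_eq_self_iff := by
    intro p
    rw [glue_eq_self_iff (fun k l h => by have := G.pt_injective h; simp_all) o.partner_ne,
      G.join_eq_self_iff]
    constructor
    · rintro ⟨⟨⟨x, k⟩, rfl⟩, h⟩
      refine ⟨⟨⟨x, ?_⟩, k⟩, rfl⟩
      rintro rfl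
      exact h ⟨k, rfl⟩
    · rintro ⟨⟨⟨x, hx⟩, k⟩, rfl⟩
      refine ⟨⟨_, rfl⟩, ?_⟩
      rintro ⟨l, hl⟩
      have h1 := G.pt_injective hl
      simp only [Prod.mk.injEq] at h1
      exact hx h1.1.symm

/-- `G / e`. -/
noncomputable def contract (G : ArrowPresentation E) (e : E) : ArrowPresentation {x : E // x ≠ e} :=
  G.surgery .con e

/-- `G \ e`. -/
noncomputable def delete (G : ArrowPresentation E) (e : E) : ArrowPresentation {x : E // x ≠ e} :=
  G.surgery .del e

/-- The Penrose-contraction of `e`. -/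
noncomputable def penrose (G : ArrowPresentation E) (e : E) : ArrowPresentation {x : E // x ≠ e} :=
  G.surgery .pen e

/-- The edgeless arrow presentation obtained by applying to every edge `e` the operation `s e`. -/
noncomputable def resolve (G : ArrowPresentation E) (s : E → EdgeOp) :
    ArrowPresentation PEmpty.{u + 1} where
  Pt := G.Pt
  finite_edges := inferInstance
  finite_pt := G.finite_pt
  arc := G.arc
  arc_involutive := G.arc_involutive
  arc_ne := G.arc_ne
  pt := fun x => x.1.elim
  pt_injective := fun x => x.1.elim
  join := glue G.pt (fun x => (x.1, (s x.1).partner x.2)) G.join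
  join_involutive := by
    refine glue_involutive G.pt_injective (fun x => ?_) G.join_involutive
      (fun k => (G.join_eq_self_iff _).2 ⟨_, rfl⟩)
    simp [(s x.1).partner_involutive x.2]
  join_eq_self_iff := by
    intro p
    rw [glue_eq_self_iff G.pt_injective
      (fun x h => (s x.1).partner_ne x.2 (congrArg Prod.snd h)), G.join_eq_self_iff]
    constructor
    · rintro ⟨h, h'⟩
      exact absurd h h'
    · rintro ⟨x, _⟩
      exact x.1.elim

/-- The weight `a_e`, `b_e` or `c_e` of an operation on `e`. -/
def weight {R : Type*} (a b c : E → R) (e : E) : EdgeOp → R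
  | .con => a e
  | .del => b e
  | .pen => c e

/-- The topological transition polynomial with values of `(a_e, b_e, c_e)` and `t` in a commutative
ring `R`, as the sum over all ways to resolve all edges. By `transitionPolynomial_rec`,
`transitionPolynomial_edgeless` and `transitionPolynomial_unique` below it is
the unique invariant which satisfies the recursion
`Q(G) = a_e Q(G / e) + b_e Q(G \ e) + c_e Q(G pen e)` for every edge `e` of every `G`, and is
`t` to the number of vertices on edgeless arrow presentations. -/
noncomputable def transitionPolynomial {R : Type*} [CommRing R] (G : ArrowPresentation E)
    (a b c : E → R) (t : R) : R :=
  ∑ᶠ s : E → EdgeOp, (∏ᶠ e, weight a b c e (s e)) * t ^ Nat.card (G.resolve s).Vertex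

instance : Fintype EdgeOp := ⟨{EdgeOp.con, EdgeOp.del, EdgeOp.pen}, fun o => by cases o <;> simp⟩

theorem resolve_surgery (G : ArrowPresentation E) (e : E) (s : E → EdgeOp) :
    (G.surgery (s e) e).resolve (fun x => s x.1) = G.resolve s := by
  have hinj : Function.Injective (fun k => G.pt (e, k)) := fun k l h => by
    have := G.pt_injective h
    simp_all
  unfold resolve
  congr 1
  · funext p
    by_cases hp : p ∈ Set.range G.pt
    · obtain ⟨⟨x, k⟩, rfl⟩ := hp
      rw [glue_apply G.pt_injective]
      by_cases hx : x = e
      · subst hx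
        refine (glue_apply_of_notMem (P := G.Pt) _ _ ?_).trans (glue_apply hinj _ _ k)
        rintro ⟨⟨⟨y, hy⟩, l⟩, h⟩
        have h1 := G.pt_injective h
        simp only [Prod.mk.injEq] at h1
        exact hy h1.1
      · exact glue_apply (G.surgery (s e) e).pt_injective
          (fun x => (x.1, (s x.1.1).partner x.2)) _ (⟨x, hx⟩, k)
    · refine Eq.trans ?_ (glue_apply_of_notMem (P := G.Pt) _ _ hp).symm
      refine (glue_apply_of_notMem (P := G.Pt) _ _ ?_).trans
        (glue_apply_of_notMem (P := G.Pt) _ _ ?_)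
      · rintro ⟨⟨⟨y, hy⟩, l⟩, h⟩
        exact hp ⟨_, h⟩
      · rintro ⟨k, rfl⟩
        exact hp ⟨_, rfl⟩

theorem transitionPolynomial_rec {R : Type*} [CommRing R] (G : ArrowPresentation E)
    (a b c : E → R) (t : R) (e : E) :
    G.transitionPolynomial a b c t =
      a e * (G.contract e).transitionPolynomial (fun x => a x.1) (fun x => b x.1)
          (fun x => c x.1) t
      + b e * (G.delete e).transitionPolynomial (fun x => a x.1) (fun x => b x.1)
          (fun x => c x.1) t
      + c e * (G.penrose e).transitionPolynomial (fun x => a x.1) (fun x => b x.1)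
          (fun x => c x.1) t := by
  classical
  have := G.finite_edges
  have := Fintype.ofFinite E
  have key : G.transitionPolynomial a b c t = ∑ o : EdgeOp, weight a b c e o *
      (G.surgery o e).transitionPolynomial (fun x => a x.1) (fun x => b x.1)
        (fun x => c x.1) t := by
    unfold transitionPolynomial
    simp only [finsum_eq_sum_of_fintype, finprod_eq_prod_of_fintype]
    simp only [Finset.mul_sum]
    rw [← Fintype.sum_prod_type', ← Equiv.sum_comp (Equiv.funSplitAt e EdgeOp)]
    refine Finset.sum_congr rfl fun s _ => ?_
    rw [Fintype.prod_eq_mul_prod_subtype_ne _ e, mul_assoc]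
    congr 2
    exact congrArg (fun A => t ^ Nat.card (Vertex A)) (resolve_surgery G e s).symm
  rw [key]
  have huniv : (Finset.univ : Finset EdgeOp) = {.con, .del, .pen} := rfl
  rw [huniv, Finset.sum_insert (by simp), Finset.sum_insert (by simp), Finset.sum_singleton,
    ← add_assoc]
  rfl

theorem transitionPolynomial_edgeless {R : Type*} [CommRing R] [IsEmpty E]
    (G : ArrowPresentation E) (a b c : E → R) (t : R) :
    G.transitionPolynomial a b c t = t ^ Nat.card G.Vertex := by
  classical
  have : Fintype E := Fintype.ofFinite E
  unfold transitionPolynomial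
  rw [finsum_eq_sum_of_fintype, Fintype.sum_unique, finprod_of_isEmpty, one_mul]
  congr 2
  have hj : (G.resolve default).join = G.join := by
    funext p
    exact glue_apply_of_notMem _ _ (by rintro ⟨⟨x, _⟩, _⟩; exact isEmptyElim x)
  have : (G.resolve default).Adjacent = G.Adjacent := by
    funext p q
    apply propext
    unfold Adjacent
    rw [hj]
    simp [resolve]
  unfold Vertex
  rw [this]
  rfl

theorem transitionPolynomial_unique {R : Type*} [CommRing R] (t : R)
    (Q : ∀ {E : Type u}, ArrowPresentation E → (E → R) → (E → R) → (E → R) → R)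
    (hrec : ∀ {E : Type u} (G : ArrowPresentation E) (a b c : E → R) (e : E),
      Q G a b c =
        a e * Q (G.contract e) (fun x => a x.1) (fun x => b x.1) (fun x => c x.1)
        + b e * Q (G.delete e) (fun x => a x.1) (fun x => b x.1) (fun x => c x.1)
        + c e * Q (G.penrose e) (fun x => a x.1) (fun x => b x.1) (fun x => c x.1))
    (hbase : ∀ {E : Type u} [IsEmpty E] (G : ArrowPresentation E) (a b c : E → R),
      Q G a b c = t ^ Nat.card G.Vertex)
    (G : ArrowPresentation E) (a b c : E → R) :
    Q G a b c = G.transitionPolynomial a b c t := by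
  have := G.finite_edges
  induction h : Nat.card E generalizing E with
  | zero =>
    have : IsEmpty E := (Finite.card_eq_zero_iff).1 h
    rw [hbase, transitionPolynomial_edgeless]
  | succ n ih =>
    have hE : Nonempty E := (Finite.card_pos_iff).1 (by omega)
    obtain ⟨e⟩ := hE
    have hc : Nat.card {x : E // x ≠ e} = n := by
      classical
      have := Fintype.ofFinite E
      rw [Nat.card_eq_fintype_card] at h ⊢
      have := Fintype.card_subtype_compl (fun x => x = e)
      simp_all
    rw [hrec G a b c e, transitionPolynomial_rec G a b c t e,
      ih _ _ _ _ inferInstance hc, ih _ _ _ _ inferInstance hc, ih _ _ _ _ inferInstance hc]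

/-- The 2-sum of `G` and `H` along the edges `f` and `e`, with respect to the coupling `φ`: the four
arrows are removed, and if `φ` sends the arrow `p₁p₂` of `f` to the arrow `q₁q₂` of `e`, then
`p₁` is identified with `q₁` and `p₂` with `q₂`. -/
noncomputable def twoSum (G : ArrowPresentation E) (H : ArrowPresentation F) (f : E) (e : F)
    (φ : Coupling) : ArrowPresentation ({x : E // x ≠ f} ⊕ {y : F // y ≠ e}) where
  Pt := G.Pt ⊕ H.Pt
  finite_edges := have := G.finite_edges; have := H.finite_edges; inferInstance
  finite_pt := have := G.finite_pt; have := H.finite_pt; inferInstance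
  arc := Sum.map G.arc H.arc
  arc_involutive := by
    rintro (p | p)
    · simp [G.arc_involutive p]
    · simp [H.arc_involutive p]
  arc_ne := by
    rintro (p | p)
    · simp [G.arc_ne p]
    · simp [H.arc_ne p]
  pt := fun z => z.1.elim (fun x => Sum.inl (G.pt (x.1, z.2))) (fun y => Sum.inr (H.pt (y.1, z.2)))
  pt_injective := by
    rintro ⟨⟨x, hx⟩ | ⟨x, hx⟩, k⟩ ⟨⟨y, hy⟩ | ⟨y, hy⟩, l⟩ h
    · have := G.pt_injective (Sum.inl_injective h)
      simp_all
    · simp at h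
    · simp at h
    · have := H.pt_injective (Sum.inr_injective h)
      simp_all
  join := glue (Sum.map (fun k => G.pt (f, k)) (fun k => H.pt (e, k)))
    (Sum.elim (fun k => Sum.inr (φ k.1, k.2)) (fun k => Sum.inl (φ.symm k.1, k.2)))
    (Sum.map G.join H.join)
  join_involutive := by
    refine glue_involutive (Function.Injective.sumMap (fun k l h => ?_) (fun k l h => ?_)) ?_ ?_ ?_
    · have := G.pt_injective h
      simp_all
    · have := H.pt_injective h
      simp_all
    · rintro (k | k) <;> simp
    · rintro (p | p)
      · simp [G.join_involutive p]
      · simp [H.join_involutive p]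
    · rintro (k | k)
      · simp [(G.join_eq_self_iff _).2 ⟨_, rfl⟩]
      · simp [(H.join_eq_self_iff _).2 ⟨_, rfl⟩]
  join_eq_self_iff := by
    intro p
    rw [glue_eq_self_iff (Function.Injective.sumMap
      (fun k l h => by have := G.pt_injective h; simp_all)
      (fun k l h => by have := H.pt_injective h; simp_all)) (by rintro (k | k) <;> simp)]
    rcases p with p | p
    · simp only [Sum.map_inl, Sum.inl.injEq, G.join_eq_self_iff]
      constructor
      · rintro ⟨⟨⟨x, k⟩, rfl⟩, h⟩
        refine ⟨⟨Sum.inl ⟨x, ?_⟩, k⟩, rfl⟩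
        rintro rfl
        exact h ⟨Sum.inl k, rfl⟩
      · rintro ⟨⟨⟨x, hx⟩ | ⟨x, hx⟩, k⟩, h⟩
        · cases Sum.inl_injective h
          refine ⟨⟨_, rfl⟩, ?_⟩
          rintro ⟨l | l, hl⟩
          · have h1 := G.pt_injective (Sum.inl_injective hl)
            simp only [Prod.mk.injEq] at h1
            exact hx h1.1.symm
          · simp at hl
        · simp at h
    · simp only [Sum.map_inr, Sum.inr.injEq, H.join_eq_self_iff]
      constructor
      · rintro ⟨⟨⟨x, k⟩, rfl⟩, h⟩
        refine ⟨⟨Sum.inr ⟨x, ?_⟩, k⟩, rfl⟩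
        rintro rfl
        exact h ⟨Sum.inr k, rfl⟩
      · rintro ⟨⟨⟨x, hx⟩ | ⟨x, hx⟩, k⟩, h⟩
        · simp at h
        · cases Sum.inr_injective h
          refine ⟨⟨_, rfl⟩, ?_⟩
          rintro ⟨l | l, hl⟩
          · simp at hl
          · have h1 := H.pt_injective (Sum.inr_injective hl)
            simp only [Prod.mk.injEq] at h1
            exact hx h1.1.symm

/-- The edges of a tensor product of an arrow presentation with edge set `E` and arrow presentations
with edge sets `L f`: all edges of the latter other than the `e f`. -/
abbrev TensorEdge {E : Type u} {L : E → Type u} (e : ∀ f, L f) : Type u :=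
  Σ f : E, {y : L f // y ≠ e f}

/-- `IsIteratedTwoSum G H e φ S T lab` says that `T` is obtained from `G` by taking, one after the
other, for each edge `f` in the set `S`, the 2-sum along `f` and `e f` with `H f` with respect to
`φ f`. Every edge of `T` is an edge of `G` or an edge of one of the `H f` other than `e f`; the map
`lab` tells which one. -/
inductive IsIteratedTwoSum {E : Type u} {L : E → Type u} (G : ArrowPresentation E)
    (H : ∀ f, ArrowPresentation (L f)) (e : ∀ f, L f) (φ : E → Coupling) :
    Set E → ∀ {D : Type u}, ArrowPresentation D → (D → E ⊕ TensorEdge e) → Prop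
  | zero : IsIteratedTwoSum G H e φ ∅ G Sum.inl
  | step {S : Set E} {D : Type u} {T : ArrowPresentation D} {lab : D → E ⊕ TensorEdge e}
      (h : IsIteratedTwoSum G H e φ S T lab) (f : E) (d : D) (hd : lab d = Sum.inl f) :
      IsIteratedTwoSum G H e φ (insert f S) (T.twoSum (H f) d (e f) (φ f))
        (Sum.elim (fun x => lab x.1) (fun y => Sum.inr ⟨f, y⟩))

/-- `T`, whose edges are labelled by `lab`, is the tensor product of `G` and the family `H` with
respect to the family `φ` of couplings: the 2-sums have been taken at all edges of `G`. -/
def IsTensorProduct {E : Type u} {L : E → Type u} (G : ArrowPresentation E)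
    (H : ∀ f, ArrowPresentation (L f)) (e : ∀ f, L f) (φ : E → Coupling)
    {D : Type u} (T : ArrowPresentation D) (lab : D → TensorEdge e) : Prop :=
  IsIteratedTwoSum G H e φ Set.univ T (fun d => Sum.inr (lab d))

/-- Tensor products always exist, and their edges are exactly those of `TensorEdge e`. -/
theorem exists_isTensorProduct {E : Type u} {L : E → Type u} (G : ArrowPresentation E)
    (H : ∀ f, ArrowPresentation (L f)) (e : ∀ f, L f) (φ : E → Coupling) :
    ∃ (D : Type u) (T : ArrowPresentation D) (lab : D → TensorEdge e),
      IsTensorProduct G H e φ T lab ∧ Function.Bijective lab := by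
  have := G.finite_edges
  have key : ∀ S : Set E, S.Finite → ∃ (D : Type u) (T : ArrowPresentation D)
      (lab : D → E ⊕ TensorEdge e), IsIteratedTwoSum G H e φ S T lab ∧
        Function.Injective lab ∧
        ∀ z, z ∈ Set.range lab ↔ Sum.elim (fun f => f ∉ S) (fun y => y.1 ∈ S) z := by
    intro S hS
    induction S, hS using Set.Finite.induction_on with
    | empty =>
      refine ⟨E, G, Sum.inl, .zero, Sum.inl_injective, ?_⟩
      rintro (f | y) <;> simp
    | @insert f S hf _ ih =>
      obtain ⟨D, T, lab, h, hinj, hr⟩ := ih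
      obtain ⟨d, hd⟩ := (hr (Sum.inl f)).2 hf
      refine ⟨_, _, _, .step h f d hd, ?_, ?_⟩
      · rintro (⟨x, hx⟩ | y) (⟨x', hx'⟩ | y') hxy
        · have := hinj hxy
          simp_all
        · have h1 := (hr (lab x)).1 ⟨x, rfl⟩
          rw [show lab x = Sum.inr ⟨f, y'⟩ from hxy] at h1
          exact absurd h1 hf
        · have h1 := (hr (lab x')).1 ⟨x', rfl⟩
          rw [show lab x' = Sum.inr ⟨f, y⟩ from hxy.symm] at h1
          exact absurd h1 hf
        · simp_all
      · intro z
        constructor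
        · rintro ⟨⟨x, hx⟩ | y, rfl⟩
          · have h1 := (hr (lab x)).1 ⟨x, rfl⟩
            have hne : lab x ≠ Sum.inl f := fun h => hx (hinj (h.trans hd.symm))
            simp only [Sum.elim_inl]
            rcases hz : lab x with g | y
            · rw [hz] at h1 hne
              simp_all
            · rw [hz] at h1
              simp_all
          · simp
        · intro hz
          rcases z with g | ⟨g, y⟩
          · simp only [Sum.elim_inl, Set.mem_insert_iff, not_or] at hz
            obtain ⟨x, hx⟩ := (hr (Sum.inl g)).2 hz.2
            refine ⟨Sum.inl ⟨x, ?_⟩, hx⟩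
            rintro rfl
            rw [hd] at hx
            exact hz.1 (Sum.inl_injective hx).symm
          · by_cases hg : g = f
            · subst hg
              exact ⟨Sum.inr y, rfl⟩
            · have hgS : g ∈ S := by simpa [hg] using hz
              obtain ⟨x, hx⟩ := (hr (Sum.inr ⟨g, y⟩)).2 hgS
              refine ⟨Sum.inl ⟨x, ?_⟩, hx⟩
              rintro rfl
              rw [hd] at hx
              simp at hx
  obtain ⟨D, T, lab, h, hinj, hr⟩ := key Set.univ Set.finite_univ
  have hlab : ∀ d, ∃ y, lab d = Sum.inr y := by
    intro d
    rcases hz : lab d with f | y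
    · have := (hr (Sum.inl f)).1 ⟨d, hz⟩
      simp at this
    · exact ⟨y, rfl⟩
  choose lab' hlab' using hlab
  have hl : lab = fun d => Sum.inr (lab' d) := funext hlab'
  subst hl
  refine ⟨D, T, lab', h, fun x y hxy => hinj (by simp [hxy]), fun y => ?_⟩
  obtain ⟨d, hd⟩ := (hr (Sum.inr y)).2 (Set.mem_univ _)
  exact ⟨d, Sum.inr_injective hd⟩

/-- The polynomial ring `ℤ[a_x, b_x, c_x, t : x ∈ D]`. The indeterminate `t` is `X none`, and
`a_x`, `b_x`, `c_x` are `X (some (x, o))` for `o = con`, `del`, `pen`. -/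
abbrev TransitionRing (D : Type u) : Type u := MvPolynomial (Option (D × EdgeOp)) ℤ

/-- The topological transition polynomial `Q(T; (a, b, c), t)` of an arrow presentation whose edges
`d` carry the indeterminates `a_x`, `b_x`, `c_x` with `x = lab d`. -/
noncomputable def genericTransition {D M : Type u} (T : ArrowPresentation D) (lab : D → M) :
    TransitionRing M :=
  T.transitionPolynomial
    (fun d => MvPolynomial.X (some (lab d, EdgeOp.con)))
    (fun d => MvPolynomial.X (some (lab d, EdgeOp.del)))
    (fun d => MvPolynomial.X (some (lab d, EdgeOp.pen)))
    (MvPolynomial.X none)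

/-- The matrix of the linear system, with rows and columns in the order contraction, deletion,
Penrose-contraction. -/
def systemMatrix {R : Type*} [CommRing R] (t : R) : Matrix (Fin 3) (Fin 3) R :=
  !![t ^ 2, t, t;
     t, t ^ 2, t;
     t, t, t ^ 2]

/-- The right-hand side of the linear system for the edge `f`: the polynomials of `H f` after
contraction, deletion and Penrose-contraction of `e f`. -/
noncomputable def systemVector {E : Type u} {L : E → Type u} (H : ∀ f, ArrowPresentation (L f))
    (e : ∀ f, L f) (f : E) : Fin 3 → TransitionRing (TensorEdge e) :=
  ![genericTransition ((H f).contract (e f)) (fun y => ⟨f, y⟩),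
    genericTransition ((H f).delete (e f)) (fun y => ⟨f, y⟩),
    genericTransition ((H f).penrose (e f)) (fun y => ⟨f, y⟩)]

end ArrowPresentation

/-! The polynomial is a state sum, so the theorem reduces to counting circles state by state.
Resolve every edge of `H` except `e`. What remains is a graph formed by two involutions: `arc`,
which has no fixed point, and the resolved `join`, whose only fixed points are the four ends of the
arrows of `e`. Its components are closed circles that avoid `e`, and paths with both ends among
those four points (`exists_other_end`). The paths therefore match the four points in pairs. Four
points have exactly three perfect matchings, and these are the matchings made by contraction,
deletion and Penrose-contraction (`exists_pairing`).

Hence each state of `H` away from `e` amounts to an operation `π` together with a number of free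
circles. Let `pairingSum` collect the weights of the states with a given `π`. Resolving `e` by `o`
closes the paths into two circles if `o = π` and into one otherwise, which gives the matrix with `t
^ 2` on the diagonal and `t` elsewhere (`transitionPolynomial_surgery`). In a 2-sum such a state has
the effect of applying `π` to `f`, apart from its free circles (`transitionPolynomial_twoSum`).
Compared with the recursion at `f`, this says that a 2-sum replaces the weights of `f` by the
pairing sums; iteration over the edges of `G` gives the tensor product formula.

The pairing sums are polynomials by construction, so existence needs no division by the determinant.
Uniqueness holds because the determinant is a nonzero polynomial in `t`. -/

/-! ### Counting classes of glued relations -/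

theorem Quot.natCard_congr {X Y : Type*} {r : X → X → Prop} {s : Y → Y → Prop}
    (f : X → Y) (g : Y → X)
    (hf : ∀ a b, r a b → Quot.mk s (f a) = Quot.mk s (f b))
    (hg : ∀ a b, s a b → Quot.mk r (g a) = Quot.mk r (g b))
    (hgf : ∀ a, Quot.mk r (g (f a)) = Quot.mk r a)
    (hfg : ∀ b, Quot.mk s (f (g b)) = Quot.mk s b) :
    Nat.card (Quot r) = Nat.card (Quot s) :=
  Nat.card_congr
    { toFun := Quot.lift (fun a => Quot.mk s (f a)) hf
      invFun := Quot.lift (fun b => Quot.mk r (g b)) hg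
      left_inv := by rintro ⟨a⟩; exact hgf a
      right_inv := by rintro ⟨b⟩; exact hfg b }

/-- The relation on `Y ⊕ X` that extends `s` and `r` and relates `κ k` to `ι k`. -/
def joinRel {K X Y : Type*} (s : Y → Y → Prop) (r : X → X → Prop) (κ : K → Y) (ι : K → X) :
    Y ⊕ X → Y ⊕ X → Prop :=
  fun a b => Sum.LiftRel s r a b ∨ ∃ k, a = Sum.inl (κ k) ∧ b = Sum.inr (ι k)

/-- The relation on `Y` that extends `s` and relates `κ k` to `κ l` whenever `ι k` and `ι l` are
in the same class of `r`. -/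
def traceRel {K X Y : Type*} (s : Y → Y → Prop) (r : X → X → Prop) (κ : K → Y) (ι : K → X) :
    Y → Y → Prop :=
  fun a b => s a b ∨ ∃ k l, Quot.mk r (ι k) = Quot.mk r (ι l) ∧ a = κ k ∧ b = κ l

/-- The classes of `r` that contain none of the points `ι k`. -/
abbrev FreeClass {K X : Type*} (r : X → X → Prop) (ι : K → X) : Type _ :=
  {c : Quot r // c ∉ Set.range fun k => Quot.mk r (ι k)}

-- A class of `r` that meets the image of `ι` is absorbed by the classes of the points `κ k`
-- attached to it, so its only effect on `Y` is to merge those. Every other class of `r` survives as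
-- a separate class. Both circle counts below are instances of this.
open Classical in
theorem natCard_quot_joinRel {K X Y : Type*} [Finite X] [Finite Y]
    (s : Y → Y → Prop) (r : X → X → Prop) (κ : K → Y) (ι : K → X) :
    Nat.card (Quot (joinRel s r κ ι)) =
      Nat.card (FreeClass r ι) + Nat.card (Quot (traceRel s r κ ι)) := by
  have hinl : ∀ a b, s a b → Quot.mk (joinRel s r κ ι) (Sum.inl a) = Quot.mk _ (Sum.inl b) :=
    fun a b h => Quot.sound (Or.inl (Sum.LiftRel.inl h))
  let inr' : Quot r → Quot (joinRel s r κ ι) := Quot.lift (fun x => Quot.mk _ (Sum.inr x))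
    (fun a b h => Quot.sound (Or.inl (Sum.LiftRel.inr h)))
  have hglue : ∀ k, Quot.mk (joinRel s r κ ι) (Sum.inl (κ k)) = inr' (Quot.mk r (ι k)) :=
    fun k => Quot.sound (Or.inr ⟨k, rfl, rfl⟩)
  -- The chosen `k` does not matter: `traceRel` identifies all `κ k` attached to one class.
  let F : Quot r → FreeClass r ι ⊕ Quot (traceRel s r κ ι) := fun c =>
    if h : c ∈ Set.range fun k => Quot.mk r (ι k) then Sum.inr (Quot.mk _ (κ h.choose))
    else Sum.inl ⟨c, h⟩
  have hF : ∀ k, F (Quot.mk r (ι k)) = Sum.inr (Quot.mk _ (κ k)) := by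
    intro k
    have h : Quot.mk r (ι k) ∈ Set.range fun k => Quot.mk r (ι k) := ⟨k, rfl⟩
    simp only [F, dif_pos h]
    exact congrArg Sum.inr (Quot.sound (Or.inr ⟨_, _, h.choose_spec, rfl, rfl⟩))
  rw [← Nat.card_sum]
  refine Nat.card_congr
    { toFun := Quot.lift (Sum.elim (fun y => Sum.inr (Quot.mk _ y)) (fun x => F (Quot.mk r x))) ?_
      invFun := Sum.elim (fun c => inr' c.1) (Quot.lift (fun y => Quot.mk _ (Sum.inl y)) ?_)
      left_inv := ?_
      right_inv := ?_ }
  · rintro _ _ ((h | h) | ⟨k, rfl, rfl⟩)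
    · exact congrArg Sum.inr (Quot.sound (Or.inl h))
    · exact congrArg F (Quot.sound h)
    · exact (hF k).symm
  · rintro a b (h | ⟨k, l, h, rfl, rfl⟩)
    · exact hinl a b h
    · exact (hglue k).trans ((congrArg inr' h).trans (hglue l).symm)
  · rintro ⟨y | x⟩
    · rfl
    · change Sum.elim _ _ (F (Quot.mk r x)) = inr' (Quot.mk r x)
      by_cases h : Quot.mk r x ∈ Set.range fun k => Quot.mk r (ι k)
      · obtain ⟨k, hk⟩ := h
        simp only [] at hk
        rw [← hk, hF]
        exact hglue k
      · simp only [F, dif_neg h]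
        rfl
  · rintro (⟨⟨x⟩, h⟩ | y)
    · exact dif_neg h
    · induction y using Quot.ind
      rfl

/-! ### Components of a pair of involutions -/

/-- Two points are related if an involution of a given pair interchanges them. -/
def PairAdj {P : Type*} (α β : P → P) (p q : P) : Prop := q = α p ∨ q = β p

/-- In the graph formed by two involutions, the first of which has no fixed point, the component of
a fixed point of the second contains exactly one further fixed point. -/
theorem exists_other_end {P : Type*} [Finite P] {α β : P → P} (hα : Function.Involutive α)
    (hne : ∀ p, α p ≠ p) (hβ : Function.Involutive β) {p : P} (hp : β p = p) :
    ∃ q, q ≠ p ∧ β q = q ∧ ∀ x, β x = x →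
      (Quot.mk (PairAdj α β) p = Quot.mk (PairAdj α β) x ↔ x = p ∨ x = q) := by
  let A : Equiv.Perm P := hα.toPerm
  let B : Equiv.Perm P := hβ.toPerm
  have hB : B * B = 1 := Equiv.ext hβ
  have hA : A * A = 1 := Equiv.ext hα
  -- The two involutions generate a dihedral group with rotation `σ`, and `B` conjugates `σ` to its
  -- inverse. As `p` is fixed by `B`, its component is its orbit under `σ`, on which both
  -- involutions act as reflections of the exponent.
  let σ : Equiv.Perm P := A * B
  have hsemi : SemiconjBy B σ σ⁻¹ := by
    have hA' : A⁻¹ = A := inv_eq_of_mul_eq_one_left hA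
    have hB' : B⁻¹ = B := inv_eq_of_mul_eq_one_left hB
    change B * (A * B) = (A * B)⁻¹ * B
    rw [mul_inv_rev, hA', hB', mul_assoc]
  have hβσ : ∀ n : ℤ, β ((σ ^ n) p) = (σ ^ (-n)) p := by
    intro n
    have h := (hsemi.zpow_right n).eq
    rw [inv_zpow'] at h
    have h2 := Equiv.congr_fun h p
    simp only [Equiv.Perm.mul_apply] at h2
    rw [show B p = p from hp] at h2
    exact h2
  have hασ : ∀ n : ℤ, α ((σ ^ n) p) = (σ ^ (1 - n)) p := by
    intro n
    have h : α ((σ ^ n) p) = σ (β ((σ ^ n) p)) := by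
      change _ = α (β (β _))
      rw [hβ]
    rw [h, hβσ, sub_eq_add_neg, zpow_one_add]
    rfl
  have hmk : ∀ n : ℤ, Quot.mk (PairAdj α β) p = Quot.mk (PairAdj α β) ((σ ^ n) p) := by
    have hσ : ∀ y, Quot.mk (PairAdj α β) y = Quot.mk (PairAdj α β) (σ y) := fun y =>
      (Quot.sound (r := PairAdj α β) (b := β y) (Or.inr rfl)).trans
        (Quot.sound (r := PairAdj α β) (Or.inl rfl))
    intro n
    induction n with
    | zero => rfl
    | succ n ih =>
      rw [add_comm, zpow_one_add, Equiv.Perm.mul_apply, ← hσ]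
      exact ih
    | pred n ih =>
      rw [hσ ((σ ^ (-(n : ℤ) - 1)) p), ← Equiv.Perm.mul_apply, ← zpow_one_add]
      simpa using ih
  have horb : ∀ x, Quot.mk (PairAdj α β) p = Quot.mk (PairAdj α β) x →
      ∃ n : ℤ, x = (σ ^ n) p := by
    intro x hx
    -- Both involutions preserve the orbit, so membership in it descends to the quotient.
    have key : ∀ a b, PairAdj α β a b → (∃ n : ℤ, a = (σ ^ n) p) = ∃ n : ℤ, b = (σ ^ n) p := by
      rintro a b (rfl | rfl)
      · refine propext ⟨?_, ?_⟩
        · rintro ⟨n, rfl⟩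
          exact ⟨_, hασ n⟩
        · rintro ⟨n, h⟩
          exact ⟨_, by rw [← hασ n, ← h, hα]⟩
      · refine propext ⟨?_, ?_⟩
        · rintro ⟨n, rfl⟩
          exact ⟨_, hβσ n⟩
        · rintro ⟨n, h⟩
          exact ⟨_, by rw [← hβσ n, ← h, hβ]⟩
    have h := congrArg (Quot.lift (fun a => ∃ n : ℤ, a = (σ ^ n) p) key) hx
    exact h.mp ⟨0, rfl⟩
  let m : ℕ := Function.minimalPeriod (σ • ·) p
  have hm : ∀ n : ℤ, (σ ^ n) p = p ↔ (m : ℤ) ∣ n := fun n =>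
    MulAction.zpow_smul_eq_iff_minimalPeriod_dvd (a := σ) (b := p)
  have hsub : ∀ n k : ℤ, (σ ^ n) p = (σ ^ k) p ↔ (m : ℤ) ∣ n - k := by
    intro n k
    rw [← hm, sub_eq_neg_add, zpow_add, Equiv.Perm.mul_apply, zpow_neg, Equiv.Perm.inv_eq_iff_eq]
  have hm0 : 0 < m := by
    rcases Nat.eq_zero_or_pos m with h | h
    · exfalso
      have hinj : Function.Injective fun n : ℤ => (σ ^ n) p := by
        intro n k hnk
        have := (hsub n k).1 hnk
        rw [h] at this
        simp at this
        omega
      exact not_injective_infinite_finite _ hinj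
    · exact h
  -- For an orbit of odd length `2 * l + 1`, the reflection `n ↦ 1 - n` fixes `l + 1` modulo the
  -- length, which would give a fixed point of `α`.
  have heven : ∃ l, m = 2 * l := by
    rcases Nat.even_or_odd' m with ⟨l, h | h⟩
    · exact ⟨l, h⟩
    · exfalso
      refine hne ((σ ^ ((l : ℤ) + 1)) p) ?_
      rw [hασ, hsub, h]
      exact ⟨-1, by push_cast; ring⟩
  obtain ⟨l, hl⟩ := heven
  -- The reflection `n ↦ -n` modulo `2 * l` fixes exactly `0` and `l`, so the other end is the
  -- antipode of `p`.
  refine ⟨(σ ^ (l : ℤ)) p, ?_, ?_, ?_⟩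
  · intro h
    rw [hm, hl, Int.natCast_dvd_natCast] at h
    have := Nat.le_of_dvd (by omega) h
    omega
  · rw [hβσ, hsub, hl]
    exact ⟨-1, by push_cast; ring⟩
  · intro x hx
    constructor
    · intro h
      obtain ⟨n, rfl⟩ := horb x h
      rw [hβσ, hsub, hl] at hx
      obtain ⟨c, hc⟩ := hx
      push_cast at hc
      rw [hm, hsub, hl]
      -- The parity of `c` decides between `p` and its antipode.
      have hn : n = l * -c := by linarith
      rcases Int.even_or_odd' c with ⟨d, hd | hd⟩
      · left
        exact ⟨-d, by rw [hn, hd]; push_cast; ring⟩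
      · right
        exact ⟨-d - 1, by rw [hn, hd]; push_cast; ring⟩
    · rintro (rfl | rfl)
      · rfl
      · exact hmk _

/-- If the second of two involutions has exactly four fixed points, indexed by the ends of two
arrows, then their components pair them up in the same way as one of the edge operations. -/
theorem exists_pairing {P : Type*} [Finite P] {α β : P → P} (hα : Function.Involutive α)
    (hne : ∀ p, α p ≠ p) (hβ : Function.Involutive β) {ι : Fin 2 × Bool → P}
    (hι : Function.Injective ι) (hfix : ∀ p, β p = p ↔ p ∈ Set.range ι) :
    ∃ π : EdgeOp, ∀ k l, Quot.mk (PairAdj α β) (ι k) = Quot.mk (PairAdj α β) (ι l) ↔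
      l = k ∨ l = π.partner k := by
  have h1 : ∀ k, ∃ m, m ≠ k ∧ ∀ l,
      Quot.mk (PairAdj α β) (ι k) = Quot.mk (PairAdj α β) (ι l) ↔ l = k ∨ l = m := by
    intro k
    obtain ⟨q, hq, hqf, h⟩ := exists_other_end hα hne hβ ((hfix _).2 ⟨k, rfl⟩)
    obtain ⟨m, rfl⟩ := (hfix q).1 hqf
    refine ⟨m, fun h => hq (congrArg ι h), fun l => ?_⟩
    rw [h _ ((hfix _).2 ⟨l, rfl⟩), hι.eq_iff, hι.eq_iff]
  choose τ hτne hτ using h1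
  have hττ : ∀ k, τ (τ k) = k := by
    intro k
    have := (hτ (τ k) k).1 ((hτ k (τ k)).2 (Or.inr rfl)).symm
    rcases this with h | h
    · exact absurd h.symm (hτne k)
    · exact h.symm
  -- A perfect matching of four points is determined by the partner of one of them, since the two
  -- points left over must be matched to each other (`key`).
  obtain ⟨π, hπ⟩ : ∃ π : EdgeOp, τ (0, false) = π.partner (0, false) := by
    have : ∀ m : Fin 2 × Bool, m ≠ (0, false) → ∃ π : EdgeOp, m = π.partner (0, false) := by
      decide
    exact this _ (hτne _)
  have key : ∀ (π : EdgeOp) (k l : Fin 2 × Bool), k ≠ (0, false) → k ≠ π.partner (0, false) →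
      l ≠ k → l ≠ (0, false) → l ≠ π.partner (0, false) → l = π.partner k := by
    decide
  refine ⟨π, fun k l => ?_⟩
  rw [hτ]
  have : τ k = π.partner k := by
    by_cases h0 : k = (0, false)
    · rw [h0, hπ]
    by_cases h1 : k = π.partner (0, false)
    · rw [h1, π.partner_involutive, ← hπ, hττ]
    refine key π k _ h0 h1 (hτne k) ?_ ?_
    · intro h
      apply h1
      rw [← hπ, ← h, hττ]
    · intro h
      apply h0
      rw [← hττ k, h, ← hπ, hττ]
  rw [this]

/-- The number of circles obtained by joining four points according to two edge operations. -/
theorem natCard_quot_partner (o π : EdgeOp) :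
    Nat.card (Quot fun k l : Fin 2 × Bool => l = o.partner k ∨ l = π.partner k) =
      if o = π then 2 else 1 := by
  split_ifs with h
  · subst h
    -- The colour `c` is what the operation leaves invariant: contraction flips both coordinates and
    -- so keeps their exclusive or, deletion keeps the arrow, and Penrose-contraction keeps the head
    -- or tail bit.
    have hc : ∃ c : Fin 2 × Bool → Bool, Function.Surjective c ∧
        ∀ k l, c k = c l ↔ l = k ∨ l = o.partner k := by
      cases o
      · exact ⟨fun k => xor (k.1 = 0) k.2, by decide, by decide⟩
      · exact ⟨fun k => k.1 = 0, by decide, by decide⟩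
      · exact ⟨fun k => k.2, by decide, by decide⟩
    obtain ⟨c, hsurj, hc⟩ := hc
    have hb : Nat.card Bool = 2 := by simp
    refine Eq.trans (Nat.card_congr (Equiv.ofBijective (Quot.lift c fun k l h => ?_) ⟨?_, ?_⟩)) hb
    · exact (hc k l).2 (h.elim Or.inr Or.inr)
    · rintro ⟨k⟩ ⟨l⟩ h
      rcases (hc k l).1 h with rfl | h
      · rfl
      · exact Quot.sound (Or.inl h)
    · intro b
      obtain ⟨k, hk⟩ := hsurj b
      exact ⟨Quot.mk _ k, hk⟩
  · rw [Nat.card_eq_one_iff_unique]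
    refine ⟨⟨?_⟩, ⟨Quot.mk _ (0, false)⟩⟩
    -- Two distinct matchings generate a Klein four-group acting transitively on the four ends.
    have key : ∀ o π : EdgeOp, o ≠ π → ∀ k l : Fin 2 × Bool, l = k ∨ l = o.partner k ∨
        l = π.partner k ∨ l = o.partner (π.partner k) := by decide
    rintro ⟨k⟩ ⟨l⟩
    rcases key o π h k l with rfl | rfl | rfl | rfl
    · rfl
    · exact Quot.sound (Or.inl rfl)
    · exact Quot.sound (Or.inr rfl)
    · exact (Quot.sound (b := π.partner k) (Or.inr rfl)).trans (Quot.sound (Or.inl rfl))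

/-! ### Circle counts after gluing -/

theorem pairAdj_sound_left {P : Type*} {α β : P → P} (p : P) :
    Quot.mk (PairAdj α β) p = Quot.mk (PairAdj α β) (α p) :=
  Quot.sound (Or.inl rfl)

theorem pairAdj_sound_right {P : Type*} {α β : P → P} (p : P) :
    Quot.mk (PairAdj α β) p = Quot.mk (PairAdj α β) (β p) :=
  Quot.sound (Or.inr rfl)

theorem pairAdj_sound_glue {K P : Type*} {α β : P → P} {ι : K → P} (hι : Function.Injective ι)
    (σ : K → K) (k : K) :
    Quot.mk (PairAdj α (glue ι σ β)) (ι k) = Quot.mk (PairAdj α (glue ι σ β)) (ι (σ k)) := by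
  have h := pairAdj_sound_right (α := α) (β := glue ι σ β) (ι k)
  rwa [glue_apply hι] at h

/-- Gluing fixed points of an involution only merges classes. -/
theorem pairAdj_sound_glue_of_fixed {K P : Type*} {α β : P → P} {ι : K → P} (σ : K → K)
    (hfix : ∀ k, β (ι k) = ι k) {p q : P} (h : PairAdj α β p q) :
    Quot.mk (PairAdj α (glue ι σ β)) p = Quot.mk (PairAdj α (glue ι σ β)) q := by
  rcases h with rfl | rfl
  · exact pairAdj_sound_left p
  · by_cases hp : p ∈ Set.range ι
    · obtain ⟨k, rfl⟩ := hp
      rw [hfix]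
    · have h := pairAdj_sound_right (α := α) (β := glue ι σ β) p
      rwa [glue_apply_of_notMem _ _ hp] at h

/-- Let the abstract four-point set carry the matching `o` and attach it to `P` along `ι`. By
`natCard_quot_joinRel`, `P` contributes its free classes and otherwise only its matching `π` of the
four points. -/
theorem natCard_quot_glue_partner {P : Type*} [Finite P] {α β : P → P} {ι : Fin 2 × Bool → P}
    (hι : Function.Injective ι) (hfix : ∀ k, β (ι k) = ι k) {π : EdgeOp}
    (hπ : ∀ k l, Quot.mk (PairAdj α β) (ι k) = Quot.mk (PairAdj α β) (ι l) ↔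
      l = k ∨ l = π.partner k) (o : EdgeOp) :
    Nat.card (Quot (PairAdj α (glue ι o.partner β))) =
      Nat.card (FreeClass (PairAdj α β) ι) + if o = π then 2 else 1 := by
  rw [← natCard_quot_partner]
  have h1 : Nat.card (Quot fun k l : Fin 2 × Bool => l = o.partner k ∨ l = π.partner k) =
      Nat.card (Quot (traceRel (fun k l => l = o.partner k) (PairAdj α β) id ι)) := by
    refine Quot.natCard_congr id id ?_ ?_ (fun _ => rfl) (fun _ => rfl)
    · rintro k l (h | h)
      · exact Quot.sound (Or.inl h)
      · exact Quot.sound (Or.inr ⟨k, l, (hπ k l).2 (Or.inr h), rfl, rfl⟩)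
    · rintro k l (h | ⟨k, l, h, rfl, rfl⟩)
      · exact Quot.sound (Or.inl h)
      · rcases (hπ k l).1 h with h | h
        · rw [h]
        · exact Quot.sound (Or.inr h)
  rw [h1, ← natCard_quot_joinRel]
  have hinr : ∀ p q, Quot.mk (PairAdj α β) p = Quot.mk (PairAdj α β) q →
      Quot.mk (joinRel (fun k l => l = o.partner k) (PairAdj α β) id ι) (Sum.inr p) =
        Quot.mk _ (Sum.inr q) := fun p q h =>
    congrArg (Quot.map Sum.inr fun _ _ h => Or.inl (Sum.LiftRel.inr h)) h
  have hinl : ∀ k, Quot.mk (joinRel (fun k l => l = o.partner k) (PairAdj α β) id ι) (Sum.inl k) =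
      Quot.mk _ (Sum.inr (ι k)) := fun k => Quot.sound (Or.inr ⟨k, rfl, rfl⟩)
  refine Quot.natCard_congr Sum.inr (Sum.elim ι id) ?_ ?_ (fun _ => rfl) ?_
  · rintro p q (rfl | rfl)
    · exact hinr _ _ (pairAdj_sound_left p)
    · by_cases hp : p ∈ Set.range ι
      · obtain ⟨k, rfl⟩ := hp
        rw [glue_apply hι, ← hinl, ← hinl]
        exact Quot.sound (Or.inl (Sum.LiftRel.inl rfl))
      · rw [glue_apply_of_notMem _ _ hp]
        exact hinr _ _ (pairAdj_sound_right p)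
  · rintro _ _ ((h | h) | ⟨k, rfl, rfl⟩)
    · subst h
      exact pairAdj_sound_glue hι _ _
    · exact pairAdj_sound_glue_of_fixed _ hfix h
    · rfl
  · rintro (k | p)
    · exact (hinl k).symm
    · rfl

/-- The identifications made in a 2-sum with coupling `φ`. -/
abbrev couple (φ : Coupling) : (Fin 2 × Bool) ⊕ (Fin 2 × Bool) → (Fin 2 × Bool) ⊕ (Fin 2 × Bool) :=
  Sum.elim (fun k => Sum.inr (φ k.1, k.2)) (fun k => Sum.inl (φ.symm k.1, k.2))

/-- A coupling either keeps or swaps the two arrows, which commutes with `Fin.rev`, and it never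
changes head and tail. This is why the choice of coupling does not affect the polynomial. -/
theorem partner_coupling (o : EdgeOp) (φ : Coupling) (k : Fin 2 × Bool) :
    o.partner (φ k.1, k.2) = (φ (o.partner k).1, (o.partner k).2) := by
  have h : ∀ φ : Equiv.Perm (Fin 2), ∀ i, φ i.rev = (φ i).rev := by decide
  obtain ⟨i, b⟩ := k
  cases o <;> simp [EdgeOp.partner, h φ]

/-- Seen from `P`, the part `P'` is a set of free classes together with paths joining the four
attaching points according to `π`. Transporting these paths along the coupling again gives the
matching `π`, by `partner_coupling`. -/
theorem natCard_quot_glue_couple {P P' : Type*} [Finite P] [Finite P'] {α β : P → P}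
    {α' β' : P' → P'} {κ : Fin 2 × Bool → P} {ι : Fin 2 × Bool → P'}
    (hκ : Function.Injective κ) (hι : Function.Injective ι)
    (hfixκ : ∀ k, β (κ k) = κ k) (hfix : ∀ k, β' (ι k) = ι k) {π : EdgeOp}
    (hπ : ∀ k l, Quot.mk (PairAdj α' β') (ι k) = Quot.mk (PairAdj α' β') (ι l) ↔
      l = k ∨ l = π.partner k) (φ : Coupling) :
    Nat.card (Quot (PairAdj (Sum.map α α')
        (glue (Sum.map κ ι) (couple φ) (Sum.map β β')))) =
      Nat.card (FreeClass (PairAdj α' β') ι) +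
        Nat.card (Quot (PairAdj α (glue κ π.partner β))) := by
  let ψ : Fin 2 × Bool → Fin 2 × Bool := fun k => (φ k.1, k.2)
  have hψ : Function.Bijective ψ := (φ.prodCongr (Equiv.refl Bool)).bijective
  -- Reindexing by the bijection `ψ` does not change which classes are met.
  have hfree : Nat.card (FreeClass (PairAdj α' β') ι) =
      Nat.card (FreeClass (PairAdj α' β') (ι ∘ ψ)) := by
    have h := hψ.surjective.range_comp fun k => Quot.mk (PairAdj α' β') (ι k)
    unfold FreeClass
    rw [← h]
    rfl
  have h1 : Nat.card (Quot (PairAdj α (glue κ π.partner β))) =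
      Nat.card (Quot (traceRel (PairAdj α β) (PairAdj α' β') κ (ι ∘ ψ))) := by
    have hbase : ∀ p q, PairAdj α β p q →
        Quot.mk (traceRel (PairAdj α β) (PairAdj α' β') κ (ι ∘ ψ)) p = Quot.mk _ q :=
      fun p q h => Quot.sound (Or.inl h)
    refine Quot.natCard_congr id id ?_ ?_ (fun _ => rfl) (fun _ => rfl)
    · rintro p q (rfl | rfl)
      · exact hbase _ _ (Or.inl rfl)
      · by_cases hp : p ∈ Set.range κ
        · obtain ⟨k, rfl⟩ := hp
          rw [glue_apply hκ]
          refine Quot.sound (Or.inr ⟨k, π.partner k, (hπ _ _).2 (Or.inr ?_), rfl, rfl⟩)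
          exact (partner_coupling π φ k).symm
        · rw [glue_apply_of_notMem _ _ hp]
          exact hbase _ _ (Or.inr rfl)
    · rintro p q (h | ⟨k, l, h, rfl, rfl⟩)
      · exact pairAdj_sound_glue_of_fixed _ hfixκ h
      · rcases (hπ _ _).1 h with h | h
        · rw [hψ.injective h]
        · rw [hψ.injective (h.trans (partner_coupling π φ k))]
          exact pairAdj_sound_glue hκ _ _
  rw [hfree, h1, ← natCard_quot_joinRel]
  have hinj : Function.Injective (Sum.map κ ι) := hκ.sumMap hι
  have hsum : ∀ p q, joinRel (PairAdj α β) (PairAdj α' β') κ (ι ∘ ψ) p q →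
      Quot.mk (joinRel (PairAdj α β) (PairAdj α' β') κ (ι ∘ ψ)) p = Quot.mk _ q :=
    fun p q h => Quot.sound h
  have hfixs : ∀ k, Sum.map β β' (Sum.map κ ι k) = Sum.map κ ι k := by
    rintro (k | k)
    · exact congrArg Sum.inl (hfixκ k)
    · exact congrArg Sum.inr (hfix k)
  refine Quot.natCard_congr id id ?_ ?_ (fun _ => rfl) (fun _ => rfl)
  · rintro p q (rfl | rfl)
    · rcases p with p | p
      · exact hsum _ _ (Or.inl (Sum.LiftRel.inl (Or.inl rfl)))
      · exact hsum _ _ (Or.inl (Sum.LiftRel.inr (Or.inl rfl)))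
    · by_cases hp : p ∈ Set.range (Sum.map κ ι)
      · obtain ⟨k, rfl⟩ := hp
        rw [glue_apply hinj]
        rcases k with k | k
        · exact hsum _ _ (Or.inr ⟨k, rfl, rfl⟩)
        · refine (hsum _ _ (Or.inr ⟨(φ.symm k.1, k.2), rfl, ?_⟩)).symm
          simp [ψ]
      · rw [glue_apply_of_notMem _ _ hp]
        rcases p with p | p
        · exact hsum _ _ (Or.inl (Sum.LiftRel.inl (Or.inr rfl)))
        · exact hsum _ _ (Or.inl (Sum.LiftRel.inr (Or.inr rfl)))
  · rintro _ _ ((h | h) | ⟨k, rfl, rfl⟩)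
    · refine pairAdj_sound_glue_of_fixed _ hfixs ?_
      rcases h with rfl | rfl
      · exact Or.inl rfl
      · exact Or.inr rfl
    · refine pairAdj_sound_glue_of_fixed _ hfixs ?_
      rcases h with rfl | rfl
      · exact Or.inl rfl
      · exact Or.inr rfl
    · exact pairAdj_sound_glue hinj (couple φ) (Sum.inl k)

theorem glue_comm {K K' P : Type*} {ι : K → P} {ι' : K' → P} (hι : Function.Injective ι)
    (hι' : Function.Injective ι') (hd : ∀ k k', ι k ≠ ι' k') (σ : K → K) (σ' : K' → K')
    (j : P → P) : glue ι σ (glue ι' σ' j) = glue ι' σ' (glue ι σ j) := by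
  funext p
  by_cases hp : p ∈ Set.range ι
  · obtain ⟨k, rfl⟩ := hp
    rw [glue_apply hι, glue_apply_of_notMem, glue_apply hι]
    rintro ⟨k', h⟩
    exact hd k k' h.symm
  · rw [glue_apply_of_notMem _ _ hp]
    by_cases hp' : p ∈ Set.range ι'
    · obtain ⟨k', rfl⟩ := hp'
      rw [glue_apply hι', glue_apply hι']
    · rw [glue_apply_of_notMem _ _ hp', glue_apply_of_notMem _ _ hp', glue_apply_of_notMem _ _ hp]

/-! ### Resolving all edges but one -/

namespace ArrowPresentation

variable {E F : Type u}

/-- The four ends of the arrows of an edge. -/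
abbrev ends (G : ArrowPresentation E) (e : E) (k : Fin 2 × Bool) : G.Pt := G.pt (e, k)

theorem ends_injective (G : ArrowPresentation E) (e : E) : Function.Injective (G.ends e) :=
  fun k l h => by simpa using G.pt_injective h

/-- The ends of the arrows of all edges but one. -/
abbrev otherEnds (G : ArrowPresentation E) (e : E) (x : {x : E // x ≠ e} × (Fin 2 × Bool)) : G.Pt :=
  G.pt (x.1.1, x.2)

theorem otherEnds_injective (G : ArrowPresentation E) (e : E) :
    Function.Injective (G.otherEnds e) := by
  rintro ⟨x, k⟩ ⟨y, l⟩ h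
  have h1 := G.pt_injective h
  simp only [Prod.mk.injEq] at h1
  exact Prod.ext (Subtype.ext h1.1) h1.2

theorem otherEnds_ne_ends (G : ArrowPresentation E) (e : E)
    (x : {x : E // x ≠ e} × (Fin 2 × Bool)) (k : Fin 2 × Bool) : G.otherEnds e x ≠ G.ends e k := by
  intro h
  have h1 := G.pt_injective h
  simp only [Prod.mk.injEq] at h1
  exact x.1.2 h1.1

/-- The identifications after all edges except `e` have been resolved. -/
noncomputable def partialJoin (G : ArrowPresentation E) (e : E) (s : {x : E // x ≠ e} → EdgeOp) :
    G.Pt → G.Pt :=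
  glue (G.otherEnds e) (fun x => (x.1, (s x.1).partner x.2)) G.join

theorem partialJoin_involutive (G : ArrowPresentation E) (e : E)
    (s : {x : E // x ≠ e} → EdgeOp) : Function.Involutive (G.partialJoin e s) := by
  refine glue_involutive (G.otherEnds_injective e) (fun x => ?_) G.join_involutive
    (fun k => (G.join_eq_self_iff _).2 ⟨_, rfl⟩)
  simp [(s x.1).partner_involutive x.2]

theorem partialJoin_eq_self_iff (G : ArrowPresentation E) (e : E)
    (s : {x : E // x ≠ e} → EdgeOp) (p : G.Pt) :
    G.partialJoin e s p = p ↔ p ∈ Set.range (G.ends e) := by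
  unfold partialJoin
  rw [glue_eq_self_iff (G.otherEnds_injective e)
    (fun x h => (s x.1).partner_ne x.2 (congrArg Prod.snd h)), G.join_eq_self_iff]
  constructor
  · rintro ⟨⟨⟨x, k⟩, rfl⟩, h⟩
    by_cases hx : x = e
    · exact ⟨k, by rw [hx]⟩
    · exact absurd ⟨(⟨x, hx⟩, k), rfl⟩ h
  · rintro ⟨k, rfl⟩
    refine ⟨⟨_, rfl⟩, ?_⟩
    rintro ⟨x, h⟩
    exact G.otherEnds_ne_ends e x k h

theorem partialJoin_ends (G : ArrowPresentation E) (e : E) (s : {x : E // x ≠ e} → EdgeOp)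
    (k : Fin 2 × Bool) : G.partialJoin e s (G.ends e k) = G.ends e k :=
  (G.partialJoin_eq_self_iff e s _).2 ⟨k, rfl⟩

theorem exists_edgePairing (G : ArrowPresentation E) (e : E) (s : {x : E // x ≠ e} → EdgeOp) :
    ∃ π : EdgeOp, ∀ k l, Quot.mk (PairAdj G.arc (G.partialJoin e s)) (G.ends e k) =
      Quot.mk (PairAdj G.arc (G.partialJoin e s)) (G.ends e l) ↔ l = k ∨ l = π.partner k :=
  have := G.finite_pt
  exists_pairing G.arc_involutive G.arc_ne (G.partialJoin_involutive e s) (G.ends_injective e)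
    (G.partialJoin_eq_self_iff e s)

/-- The way in which the ends of the arrows of `e` are connected after all other edges have been
resolved. -/
noncomputable def edgePairing (G : ArrowPresentation E) (e : E) (s : {x : E // x ≠ e} → EdgeOp) :
    EdgeOp :=
  (G.exists_edgePairing e s).choose

theorem edgePairing_spec (G : ArrowPresentation E) (e : E) (s : {x : E // x ≠ e} → EdgeOp)
    (k l : Fin 2 × Bool) :
    Quot.mk (PairAdj G.arc (G.partialJoin e s)) (G.ends e k) =
      Quot.mk (PairAdj G.arc (G.partialJoin e s)) (G.ends e l) ↔
        l = k ∨ l = (G.edgePairing e s).partner k :=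
  (G.exists_edgePairing e s).choose_spec k l

/-- The number of circles avoiding `e` after all other edges have been resolved. -/
noncomputable def freeCircles (G : ArrowPresentation E) (e : E) (s : {x : E // x ≠ e} → EdgeOp) :
    ℕ :=
  Nat.card (FreeClass (PairAdj G.arc (G.partialJoin e s)) (G.ends e))

/-- No arrow is left after resolution, so circles are components of a pair of involutions. -/
theorem natCard_vertex_resolve (G : ArrowPresentation E) (s : E → EdgeOp) :
    Nat.card (G.resolve s).Vertex = Nat.card (Quot (PairAdj G.arc (G.resolve s).join)) := by
  have h : (G.resolve s).Adjacent = PairAdj G.arc (G.resolve s).join := by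
    funext p q
    refine propext ⟨?_, ?_⟩
    · rintro (h | h | ⟨x, _⟩)
      · exact Or.inl h
      · exact Or.inr h
      · exact x.elim
    · rintro (h | h)
      · exact Or.inl h
      · exact Or.inr (Or.inl h)
  unfold Vertex
  rw [h]
  rfl

/-- Different edges have disjoint ends, so `e` may be resolved last instead of first. -/
theorem resolve_surgery_join (G : ArrowPresentation E) (e : E) (o : EdgeOp)
    (s : {x : E // x ≠ e} → EdgeOp) :
    ((G.surgery o e).resolve s).join = glue (G.ends e) o.partner (G.partialJoin e s) :=
  glue_comm (G.otherEnds_injective e) (G.ends_injective e) (G.otherEnds_ne_ends e) _ _ _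

theorem natCard_vertex_resolve_surgery (G : ArrowPresentation E) (e : E) (o : EdgeOp)
    (s : {x : E // x ≠ e} → EdgeOp) :
    Nat.card ((G.surgery o e).resolve s).Vertex =
      G.freeCircles e s + if o = G.edgePairing e s then 2 else 1 := by
  have := G.finite_pt
  rw [natCard_vertex_resolve, resolve_surgery_join]
  exact natCard_quot_glue_partner (G.ends_injective e) (G.partialJoin_ends e s)
    (G.edgePairing_spec e s) o

theorem resolve_twoSum_join (G : ArrowPresentation E) (H : ArrowPresentation F) (f : E) (e : F)
    (φ : Coupling) (s : {x : E // x ≠ f} → EdgeOp) (s' : {y : F // y ≠ e} → EdgeOp) :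
    ((G.twoSum H f e φ).resolve (Sum.elim s s')).join =
      glue (Sum.map (G.ends f) (H.ends e)) (couple φ)
        (Sum.map (G.partialJoin f s) (H.partialJoin e s')) := by
  have hinj := (G.twoSum H f e φ).pt_injective
  refine (glue_comm hinj ((G.ends_injective f).sumMap (H.ends_injective e)) ?_ _ _ _).trans ?_
  · rintro ⟨x | y, k⟩ (l | l) h
    · exact G.otherEnds_ne_ends f (x, k) l (Sum.inl_injective h)
    · exact Sum.inl_ne_inr h
    · exact Sum.inr_ne_inl h
    · exact H.otherEnds_ne_ends e (y, k) l (Sum.inr_injective h)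
  · refine congrArg _ (funext fun p => ?_)
    by_cases hp : p ∈ Set.range (G.twoSum H f e φ).pt
    · obtain ⟨⟨x | y, k⟩, rfl⟩ := hp
      · refine (glue_apply hinj _ _ _).trans (congrArg Sum.inl ?_)
        exact (glue_apply (G.otherEnds_injective f) (fun x => (x.1, (s x.1).partner x.2)) G.join
          (x, k)).symm
      · refine (glue_apply hinj _ _ _).trans (congrArg Sum.inr ?_)
        exact (glue_apply (H.otherEnds_injective e) (fun y => (y.1, (s' y.1).partner y.2)) H.join
          (y, k)).symm
    · refine (glue_apply_of_notMem _ _ hp).trans ?_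
      rcases p with p | p
      · refine congrArg Sum.inl (glue_apply_of_notMem _ _ ?_).symm
        rintro ⟨⟨x, k⟩, rfl⟩
        exact hp ⟨(Sum.inl x, k), rfl⟩
      · refine congrArg Sum.inr (glue_apply_of_notMem _ _ ?_).symm
        rintro ⟨⟨x, k⟩, rfl⟩
        exact hp ⟨(Sum.inr x, k), rfl⟩

/-- A state of `H` away from `e` influences `G` only through the operation it induces on `f`. -/
theorem natCard_vertex_resolve_twoSum (G : ArrowPresentation E) (H : ArrowPresentation F) (f : E)
    (e : F) (φ : Coupling) (s : {x : E // x ≠ f} → EdgeOp) (s' : {y : F // y ≠ e} → EdgeOp) :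
    Nat.card ((G.twoSum H f e φ).resolve (Sum.elim s s')).Vertex =
      H.freeCircles e s' + Nat.card ((G.surgery (H.edgePairing e s') f).resolve s).Vertex := by
  have := G.finite_pt
  have := H.finite_pt
  rw [natCard_vertex_resolve, natCard_vertex_resolve, resolve_twoSum_join, resolve_surgery_join]
  exact natCard_quot_glue_couple (G.ends_injective f) (H.ends_injective e)
    (G.partialJoin_ends f s) (H.partialJoin_ends e s') (H.edgePairing_spec e s') φ

/-! ### State sums grouped by induced pairing -/

variable {R : Type*} [CommRing R]

open Classical in
/-- The sum of the weights of all ways to resolve the edges other than `e` which connect the ends of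
the arrows of `e` like the operation `o` does. -/
noncomputable def pairingSum (H : ArrowPresentation F) (e : F) (a b c : {y : F // y ≠ e} → R)
    (t : R) (o : EdgeOp) : R :=
  ∑ᶠ s : {y : F // y ≠ e} → EdgeOp, if H.edgePairing e s = o then
    (∏ᶠ y, weight a b c y (s y)) * t ^ H.freeCircles e s else 0

theorem transitionPolynomial_surgery (H : ArrowPresentation F) (e : F)
    (a b c : {y : F // y ≠ e} → R) (t : R) (o : EdgeOp) :
    (H.surgery o e).transitionPolynomial a b c t =
      ∑ π : EdgeOp, (if o = π then t ^ 2 else t) * H.pairingSum e a b c t π := by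
  classical
  have := H.finite_edges
  have := Fintype.ofFinite F
  unfold transitionPolynomial pairingSum
  simp only [finsum_eq_sum_of_fintype, finprod_eq_prod_of_fintype, Finset.mul_sum]
  -- For a fixed state `s` only the term with `π = H.edgePairing e s` survives.
  rw [Finset.sum_comm]
  refine Finset.sum_congr rfl fun s _ => ?_
  simp only [mul_ite, mul_zero, Finset.sum_ite_eq, Finset.mem_univ, if_true]
  rw [natCard_vertex_resolve_surgery, pow_add]
  split_ifs <;> ring

theorem transitionPolynomial_twoSum (G : ArrowPresentation E) (H : ArrowPresentation F) (f : E)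
    (e : F) (φ : Coupling) (a b c : {x : E // x ≠ f} ⊕ {y : F // y ≠ e} → R) (t : R) :
    (G.twoSum H f e φ).transitionPolynomial a b c t =
      ∑ π : EdgeOp, H.pairingSum e (a ∘ Sum.inr) (b ∘ Sum.inr) (c ∘ Sum.inr) t π *
        (G.surgery π f).transitionPolynomial (a ∘ Sum.inl) (b ∘ Sum.inl) (c ∘ Sum.inl) t := by
  classical
  have := H.finite_edges
  have := Fintype.ofFinite F
  have := G.finite_edges
  have := Fintype.ofFinite E
  have hw : ∀ z o, weight a b c z o = Sum.elim
      (fun x => weight (a ∘ Sum.inl) (b ∘ Sum.inl) (c ∘ Sum.inl) x o)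
      (fun y => weight (a ∘ Sum.inr) (b ∘ Sum.inr) (c ∘ Sum.inr) y o) z := by
    rintro (x | y) o <;> cases o <;> rfl
  unfold transitionPolynomial pairingSum
  simp only [finsum_eq_sum_of_fintype, finprod_eq_prod_of_fintype, Finset.sum_mul]
  -- A state of the 2-sum is a pair of states, one on each summand; that of `H` selects `π`.
  rw [Finset.sum_comm, ← Equiv.sum_comp (Equiv.sumArrowEquivProdArrow _ _ _).symm,
    Fintype.sum_prod_type, Finset.sum_comm]
  refine Finset.sum_congr rfl fun s' _ => ?_
  simp only [ite_mul, zero_mul, Finset.sum_ite_eq, Finset.mem_univ, if_true]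
  rw [Finset.mul_sum]
  refine Finset.sum_congr rfl fun s _ => ?_
  rw [show (Equiv.sumArrowEquivProdArrow _ _ _).symm (s, s') = Sum.elim s s' from rfl,
    natCard_vertex_resolve_twoSum, Fintype.prod_sum_type, pow_add]
  simp only [hw, Sum.elim_inl, Sum.elim_inr]
  ring

/-! ### The linear system and iterated 2-sums -/

theorem sum_edgeOp {M : Type*} [AddCommMonoid M] (g : EdgeOp → M) :
    ∑ o, g o = g .con + g .del + g .pen := by
  have huniv : (Finset.univ : Finset EdgeOp) = {.con, .del, .pen} := rfl
  rw [huniv, Finset.sum_insert (by simp), Finset.sum_insert (by simp), Finset.sum_singleton,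
    ← add_assoc]

theorem systemMatrix_mulVec_pairingSum (H : ArrowPresentation F) (e : F)
    (a b c : {y : F // y ≠ e} → R) (t : R) :
    (systemMatrix t).mulVec
        ![H.pairingSum e a b c t .con, H.pairingSum e a b c t .del, H.pairingSum e a b c t .pen] =
      ![(H.contract e).transitionPolynomial a b c t, (H.delete e).transitionPolynomial a b c t,
        (H.penrose e).transitionPolynomial a b c t] := by
  unfold contract delete penrose
  simp only [transitionPolynomial_surgery, sum_edgeOp]
  funext i
  fin_cases i <;>
    simp [systemMatrix, Matrix.mulVec, dotProduct, Fin.sum_univ_three]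

theorem systemMatrix_det (t : R) : (systemMatrix t).det = t ^ 3 * (t - 1) ^ 2 * (t + 2) := by
  simp [systemMatrix, Matrix.det_fin_three]
  ring

theorem systemMatrix_X_mulVec_injective {D : Type u} : Function.Injective
    (systemMatrix (MvPolynomial.X none : TransitionRing D)).mulVec := by
  refine Matrix.mulVec_injective_of_det_ne_zero ?_
  rw [systemMatrix_det]
  intro h
  -- The value `2` avoids the roots `0`, `1` and `-2` of the determinant.
  have h1 := congrArg (MvPolynomial.eval fun _ => (2 : ℤ)) h
  norm_num at h1

/-- In an iterated 2-sum, the edges of the summands contribute through `pairingSum`. -/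
theorem IsIteratedTwoSum.transitionPolynomial_eq {L : E → Type u} {G : ArrowPresentation E}
    {H : ∀ f, ArrowPresentation (L f)} {e : ∀ f, L f} {φ : E → Coupling} {S : Set E} {D : Type u}
    {T : ArrowPresentation D} {lab : D → E ⊕ TensorEdge e}
    (h : IsIteratedTwoSum G H e φ S T lab) (w : EdgeOp → TensorEdge e → R) (t : R)
    (ψ : EdgeOp → E → R) (hψ : ∀ o f, ψ o f = (H f).pairingSum (e f)
      (fun y => w .con ⟨f, y⟩) (fun y => w .del ⟨f, y⟩) (fun y => w .pen ⟨f, y⟩) t o) :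
    T.transitionPolynomial (fun d => Sum.elim (ψ .con) (w .con) (lab d))
        (fun d => Sum.elim (ψ .del) (w .del) (lab d))
        (fun d => Sum.elim (ψ .pen) (w .pen) (lab d)) t =
      G.transitionPolynomial (ψ .con) (ψ .del) (ψ .pen) t := by
  induction h with
  | zero => rfl
  | step h f d hd ih =>
    -- The 2-sum expansion is the recursion at `d` with the pairing sums as weights of `d`, and
    -- these are the weights that `ψ` assigns to its label `f`.
    rw [← ih, transitionPolynomial_twoSum, sum_edgeOp, transitionPolynomial_rec _ _ _ _ _ d, hd]
    simp only [Sum.elim_inl, hψ]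
    rfl

end ArrowPresentation

open ArrowPresentation in
theorem mainTheorem9 {E : Type u} {L : E → Type u} (G : ArrowPresentation E)
    (H : ∀ f : E, ArrowPresentation (L f)) (e : ∀ f : E, L f) (φ : E → Coupling)
    {D : Type u} (T : ArrowPresentation D) (lab : D → TensorEdge e)
    (hT : IsTensorProduct G H e φ T lab) :
    (∀ f : E, ∃! v : Fin 3 → TransitionRing (TensorEdge e),
      (systemMatrix (MvPolynomial.X none)).mulVec v = systemVector H e f) ∧
    ∀ ϕ : E → Fin 3 → TransitionRing (TensorEdge e),
      (∀ f : E, (systemMatrix (MvPolynomial.X none)).mulVec (ϕ f) = systemVector H e f) →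
      genericTransition T lab =
        G.transitionPolynomial (fun f => ϕ f 0) (fun f => ϕ f 1) (fun f => ϕ f 2)
          (MvPolynomial.X none) := by
  let w : EdgeOp → TensorEdge e → TransitionRing (TensorEdge e) := fun o x =>
    MvPolynomial.X (some (x, o))
  let ψ : EdgeOp → E → TransitionRing (TensorEdge e) := fun o f => (H f).pairingSum (e f)
    (fun y => w .con ⟨f, y⟩) (fun y => w .del ⟨f, y⟩) (fun y => w .pen ⟨f, y⟩)
    (MvPolynomial.X none) o
  have hsol : ∀ f, (systemMatrix (MvPolynomial.X none)).mulVec ![ψ .con f, ψ .del f, ψ .pen f] =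
      systemVector H e f := fun f => systemMatrix_mulVec_pairingSum (H f) (e f) _ _ _ _
  refine ⟨fun f => ⟨_, hsol f, fun v hv =>
    systemMatrix_X_mulVec_injective (hv.trans (hsol f).symm)⟩, fun ϕ hϕ => ?_⟩
  -- By uniqueness, any given solution consists of the pairing sums.
  have hϕψ : ∀ f, ϕ f = ![ψ .con f, ψ .del f, ψ .pen f] := fun f =>
    systemMatrix_X_mulVec_injective ((hϕ f).trans (hsol f).symm)
  simp only [hϕψ]
  exact IsIteratedTwoSum.transitionPolynomial_eq hT w (MvPolynomial.X none) ψ fun _ _ => rfl
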